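/- Let $(\mathcal X,d)$ be a Polish metric space and let $G$ be a second countable locally compact topological group acting on $\mathcal X$ by isometries. For a finite set $Y\subset\mathcal X$ let $\mathrm{stab}_G(Y)$ denote its pointwise stabilizer. Assume that the action is strongly topological, i.e. for every finite $Y\subset\mathcal X$ and every $x\in\mathcal X\setminus Y$ the group $\mathrm{stab}_G(Y\cup\{x\})$ is closed in $\mathrm{stab}_G(Y)$ and has measure $0$ with respect to the Haar measure of $\mathrm{stab}_G(Y)$. Assume also that $\mathrm{stab}_G(Y)\neq\{1\}$ for every finite $Y\subset\mathcal X$. Let $t\in\mathbb N$, let $\mathbb F_t$ be the free group on $y_1,\dots,y_t$, and let $w(\bar y)\neq 1$ be a reduced word in $\mathbb F_t*G$ which either lies in $\mathbb F_t$ or has the form $$w=\mathsf u_n v_n\mathsf u_{n-1}v_{n-1}\cdots \mathsf u_1v_1,\qquad n\ge 1,\quad \mathsf u_i\in\mathbb F_t,\quad v_i\in G\setminus\{1\},\quad \mathsf u_i\ne 1 \text{ for } i<n .$$ Let $|w|$ be the number of occurrences of letters $y_j^{\pm1}$ in $w$ (constants are not counted). In the second case put $O_w=\bigcap_{i=0}^{n-1}v_1^{-1}\cdots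 v_i^{-1}(\mathrm{supp}(v_{i+1}))$, where $\mathrm{supp}(v)=\{x\in\mathcal X: v(x)\neq x\}$; if $w\in\mathbb F_t$ put $O_w=\mathcal X\setminus\mathrm{Fix}(G)$, where $\mathrm{Fix}(G)$ is the set of points fixed by all elements of $G$. Assume that $w$ is explicitly oscillating, i.e. $O_w\neq\emptyset$. Let $s\in\mathcal X$, $q\in\mathbb R$, let $B_r(s)$ be the open ball of radius $r$ about $s$, and suppose that $B_{(|w|+1)q}(s)\subseteq O_w$ and that $v_i(B_q(s))\subseteq B_q(s)$ for every constant $v_i$ of $w$. Let $N^q(s,\mathrm{id})=\{g\in G: d(g(s),s)<q\}$. Then, with respect to the product $\mu^t$ of a left Haar measure $\mu$ on $G$, almost every $t$-tuple $\bar\gamma\in G^t$ with $\gamma_1,\dots,\gamma_t\in N^q(s,\mathrm{id})$ satisfies $w(\bar\gamma)\neq 1$. -/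

import Mathlib

open MeasureTheory

/-- The action of the topological group `G` on the set `X` is strongly topological: for every finite
`Y ⊆ X` and every `x ∈ X \ Y`, the pointwise stabilizer of `Y ∪ {x}` is closed in the pointwise
stabilizer of `Y` (with the subspace topology) and is a null set for the Haar measure of the
latter group. -/
def IsStronglyTopological (G X : Type*) [Group G] [TopologicalSpace G] [MeasurableSpace G]
    [MulAction G X] : Prop :=
  ∀ (Y : Finset X) (x : X), x ∉ Y →
    IsClosed ((fixingSubgroup G (insert x (Y : Set X))).subgroupOf
      (fixingSubgroup G (Y : Set X)) : Set (fixingSubgroup G (Y : Set X))) ∧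
    ∀ ν : Measure (fixingSubgroup G (Y : Set X)), ν.IsHaarMeasure →
      ν ((fixingSubgroup G (insert x (Y : Set X))).subgroupOf
        (fixingSubgroup G (Y : Set X)) : Set (fixingSubgroup G (Y : Set X))) = 0

/-- The expressions for words with constants from `G` in the variables `y₁, …, yₜ` to which the
notions below apply: either an element `u` of the free group `F_t`, or an expression
`uₙ vₙ ⋯ u₁ v₁` with `uᵢ ∈ F_t` and `vᵢ ∈ G`, recorded as the list `[(u₁, v₁), …, (uₙ, vₙ)]`
(so in the order in which the factors act on points, from right to left). -/
inductive MixedForm (t : ℕ) (G : Type*)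
  | free (u : FreeGroup (Fin t)) : MixedForm t G
  | blocks (l : List (FreeGroup (Fin t) × G)) : MixedForm t G

namespace MixedForm

variable {t : ℕ} {G : Type*} [Group G]

/-- The element `uₙ vₙ ⋯ u₁ v₁` of the free product `F_t * G`. -/
def blocksWord : List (FreeGroup (Fin t) × G) → Monoid.Coprod (FreeGroup (Fin t)) G
  | [] => 1
  | b :: l => blocksWord l * (Monoid.Coprod.inl b.1 * Monoid.Coprod.inr b.2)

/-- The element of the free product `F_t * G` given by the expression. -/
def toWord : MixedForm t G → Monoid.Coprod (FreeGroup (Fin t)) G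
  | free u => Monoid.Coprod.inl u
  | blocks l => blocksWord l

/-- The expression is reduced in `F_t * G`. For `uₙ vₙ ⋯ u₁ v₁` this means that `n ≥ 1`, all `vᵢ` are
nontrivial, and all `uᵢ` except possibly the leftmost one, `uₙ`, are nontrivial. -/
def IsReduced : MixedForm t G → Prop
  | free _ => True
  | blocks l => l ≠ [] ∧ (∀ b ∈ l, b.2 ≠ 1) ∧ ∀ b ∈ l.dropLast, b.1 ≠ 1

/-- The length `|w|`: the number of occurrences of the letters `yᵢ^{±1}` (constants are not counted). -/
def length : MixedForm t G → ℕ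
  | free u => u.norm
  | blocks l => (l.map fun b => b.1.norm).sum

/-- The constants `v₁, …, vₙ` of the expression. -/
def constants : MixedForm t G → List G
  | free _ => []
  | blocks l => l.map Prod.snd

/-- The intersection of the sets `v₁⁻¹ ⋯ vᵢ⁻¹ (supp vᵢ₊₁)` for `i = 0, …, n - 1`, computed by
`supp v₁ ∩ v₁⁻¹ (supp v₂ ∩ v₂⁻¹ (supp v₃ ∩ ⋯))`. -/
def blocksOscSet (X : Type*) [MulAction G X] : List (FreeGroup (Fin t) × G) → Set X
  | [] => Set.univ
  | b :: l => {x | b.2 • x ≠ x} ∩ {x | b.2 • x ∈ blocksOscSet X l}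

/-- The set `O_w ⊆ X`; for a word without constants it is the complement of the set `Fix(G)` of points
fixed by all of `G`. -/
def oscSet (X : Type*) [MulAction G X] : MixedForm t G → Set X
  | free _ => (MulAction.fixedPoints G X)ᶜ
  | blocks l => blocksOscSet X l

/-- The word is explicitly oscillating (in `X`): it is nontrivial and `O_w` is nonempty. -/
def ExplicitlyOscillating (X : Type*) [MulAction G X] (w : MixedForm t G) : Prop :=
  w.toWord ≠ 1 ∧ (w.oscSet X).Nonempty

/-- The value `w(γ) ∈ G` under the substitution `yᵢ = γᵢ`. -/
def eval (γ : Fin t → G) (w : MixedForm t G) : G :=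
  Monoid.Coprod.lift (FreeGroup.lift γ) (MonoidHom.id G) w.toWord

end MixedForm

/-- The set of those `g ∈ G` that move the point `s` by less than `q`. -/
def moveLT (G : Type*) {X : Type*} [MetricSpace X] [Group G] [MulAction G X] (q : ℝ) (s : X) :
    Set G :=
  {g | dist (g • s) s < q}

/-! Tuples with prescribed values at finitely many points form a coset of a stabilizer in $G^t$,
which carries Haar measure. By strong topologicality, within such a coset the value of $\gamma_j$ at
an unprescribed point almost surely avoids any given finite set. So the trajectory of a point under
$w(\bar\gamma)$ can be exposed one value at a time: each letter acts at a fresh point, and the last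
value avoids the single point that would close the trajectory. Hence $w(\bar\gamma)$ moves a point.
Freshness can fail unavoidably only by backtracking, when the constant between a letter and its
inverse fixes the current point; reducedness and oscillation exclude this.

Constants and letters each move `s` by less than `q`, so a step costs at most `2q`. Starting in the
middle of the word and walking both ways keeps the points where fixed points must be excluded within
`|w|q` of `s`; the extra `q` in the hypothesis absorbs the translations in the definition of $O_w$.

The carrying lemmas are `measure_mem_and_slice_null` (Fubini along cosets), `nullAt_step` (one
letter), `nullAt_of_walk` (one trajectory) and `nullAt_forall_smul_eq` (both directions). -/

/-! ### Fubini along cosets. -/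

section Slicing

variable {Γ H : Type*} [Group Γ] [TopologicalSpace Γ] [IsTopologicalGroup Γ]
  [SecondCountableTopology Γ] [MeasurableSpace Γ] [BorelSpace Γ]
  [Group H] [TopologicalSpace H] [IsTopologicalGroup H] [MeasurableSpace H] [BorelSpace H]

/-- A form of Fubini's theorem for the slices of a set along the cosets of the image of `H`: almost
every point of `A` lies on a coset that meets `A` in a set of positive measure. -/
theorem measure_mem_and_slice_null (μ : Measure Γ) [μ.IsMulLeftInvariant] [SFinite μ]
    (ν : Measure H) [ν.IsMulLeftInvariant] [SFinite ν] [NeZero ν]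
    (ι : H →* Γ) (hι : Continuous ι) {A : Set Γ} (hA : MeasurableSet A) :
    μ {a | a ∈ A ∧ ν {h | a * ι h ∈ A} = 0} = 0 := by
  have hm : Measurable fun z : Γ × H => z.1 * ι z.2 :=
    measurable_fst.mul (hι.measurable.comp measurable_snd)
  have hm' : Measurable fun z : H × Γ => z.2 * ι z.1 :=
    measurable_snd.mul (hι.measurable.comp measurable_fst)
  have hslice : Measurable fun a : Γ => ν {h | a * ι h ∈ A} :=
    measurable_measure_prodMk_left (ν := ν) (hm hA)
  set C : Set Γ := {a | a ∈ A ∧ ν {h | a * ι h ∈ A} = 0} with hC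
  have hCm : MeasurableSet C := hA.inter (hslice (measurableSet_singleton 0))
  -- Slices at points of one coset are left translates of each other, so a coset with a non-null
  -- slice misses `C`.
  have hslice0 : ∀ a, ν {h | a * ι h ∈ C} = 0 := by
    intro a
    by_cases ha : ν {h | a * ι h ∈ A} = 0
    · exact measure_mono_null (fun h hh => hh.1) ha
    · convert measure_empty (μ := ν)
      refine Set.eq_empty_of_forall_notMem fun h hh => ha ?_
      have h2 := hh.2
      rw [← h2, ← measure_preimage_mul ν h]
      congr 1
      ext k
      simp [mul_assoc]
  have hprod : (μ.prod ν) ((fun z : Γ × H => z.1 * ι z.2) ⁻¹' C) = 0 := by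
    rw [Measure.measure_prod_null (hm hCm)]
    exact Filter.Eventually.of_forall hslice0
  have hswap := Measure.measure_ae_null_of_prod_null
    (μ := ν) (ν := μ) (s := (fun z : H × Γ => z.2 * ι z.1) ⁻¹' C) (by
      rw [← Measure.prod_swap, Measure.map_apply measurable_swap (hm' hCm)]
      exact hprod)
  -- One right translate of `C` is null, and right translation preserves `μ`-null sets.
  obtain ⟨h, hh⟩ := hswap.exists
  exact (measure_mul_right_null μ (ι h)).1 hh

end Slicing

/-! ### Null sets supplied by strong topologicality. -/

section Stabilizers

variable {X G : Type*} [Group G] [TopologicalSpace G] [IsTopologicalGroup G]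
  [MeasurableSpace G] [MulAction G X]

theorem IsStronglyTopological.isClosed_smul_eq (hstrong : IsStronglyTopological G X) (x y : X) :
    IsClosed {g : G | g • x = y} := by
  have hstab : IsClosed {g : G | g • x = x} := by
    have h := (hstrong ∅ x (by simp)).1
    have hi : Continuous fun g : G =>
        (⟨g, by simp⟩ : fixingSubgroup G ((∅ : Finset X) : Set X)) := by
      fun_prop
    convert h.preimage hi
    ext g
    simp [Subgroup.mem_subgroupOf, mem_fixingSubgroup_iff]
  by_cases hy : ∃ g₀ : G, g₀ • x = y
  · obtain ⟨g₀, rfl⟩ := hy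
    convert hstab.preimage (continuous_const_mul g₀⁻¹)
    ext g
    simp [mul_smul, inv_smul_eq_iff]
  · convert isClosed_empty
    ext g
    simpa using fun h => hy ⟨g, h⟩

theorem IsStronglyTopological.isClosed_fixingSubgroup (hstrong : IsStronglyTopological G X)
    (Y : Set X) : IsClosed (fixingSubgroup G Y : Set G) := by
  have : (fixingSubgroup G Y : Set G) = ⋂ x ∈ Y, {g : G | g • x = x} := by
    ext g; simp [mem_fixingSubgroup_iff]
  rw [this]
  exact isClosed_biInter fun x _ => hstrong.isClosed_smul_eq x x

variable [BorelSpace G]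

/-- The set is empty or a left coset of the stabilizer of `Y ∪ {x}` in that of `Y`. -/
theorem IsStronglyTopological.measure_smul_eq (hstrong : IsStronglyTopological G X)
    {Y : Finset X} {x : X} (hx : x ∉ Y) (ν : Measure (fixingSubgroup G (Y : Set X)))
    [ν.IsHaarMeasure] (c : G) (y : X) :
    ν {k | (c * k) • x = y} = 0 := by
  by_cases hk : ∃ k₀ : fixingSubgroup G (Y : Set X), (c * k₀) • x = y
  · obtain ⟨k₀, hk₀⟩ := hk
    rw [← measure_preimage_mul ν k₀, ← (hstrong Y x hx).2 ν inferInstance]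
    congr 1
    ext k
    have hkY : ∀ z ∈ Y, (k : G) • z = z := fun z hz =>
      (mem_fixingSubgroup_iff G).1 k.2 z (by simpa using hz)
    have : (c * (k₀ * k : G)) • x = y ↔ (k : G) • x = x := by
      rw [← hk₀]; simp [mul_smul]
    simpa [Subgroup.mem_subgroupOf, mem_fixingSubgroup_iff, this] using fun _ => hkY
  · convert measure_empty (μ := ν)
    ext k
    simpa using fun h => hk ⟨k, h⟩

variable [LocallyCompactSpace G] [SecondCountableTopology G]
  {Γ : Type*} [Group Γ] [TopologicalSpace Γ] [IsTopologicalGroup Γ]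
  [SecondCountableTopology Γ] [MeasurableSpace Γ] [BorelSpace Γ]

/-- On every coset of the image of `ι` the condition for a single `y ∈ F` is null by
`measure_smul_eq`, so Fubini applies. It is used for `G` itself and for one coordinate of a
stabilizer of tuples. -/
theorem IsStronglyTopological.measure_hom_smul_mem (hstrong : IsStronglyTopological G X)
    {Y : Finset X} {x : X} (hx : x ∉ Y) (μ : Measure Γ) [μ.IsMulLeftInvariant] [SFinite μ]
    (ι : fixingSubgroup G (Y : Set X) →* Γ) (hι : Continuous ι)
    (π : Γ →* G) (hπ : Continuous π) (hπι : ∀ k, π (ι k) = k) (c : G) {F : Set X}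
    (hF : F.Finite) :
    μ {h | (c * π h) • x ∈ F} = 0 := by
  have : LocallyCompactSpace (fixingSubgroup G (Y : Set X)) :=
    (hstrong.isClosed_fixingSubgroup _).isClosedEmbedding_subtypeVal.locallyCompactSpace
  have : SecondCountableTopology (fixingSubgroup G (Y : Set X)) :=
    TopologicalSpace.Subtype.secondCountableTopology _
  have hone : ∀ y, μ {h | (c * π h) • x = y} = 0 := by
    intro y
    have hm : MeasurableSet {h | (c * π h) • x = y} :=
      ((hstrong.isClosed_smul_eq x y).preimage (continuous_const.mul hπ)).measurableSet
    have := measure_mem_and_slice_null μ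
      (Measure.haar : Measure (fixingSubgroup G (Y : Set X))) ι hι hm
    convert this using 2
    ext a
    simp only [Set.mem_ofPred_eq, map_mul, hπι, ← mul_assoc]
    exact ⟨fun h => ⟨h, hstrong.measure_smul_eq hx _ _ _⟩, fun h => h.1⟩
  have : {h | (c * π h) • x ∈ F} = ⋃ y ∈ F, {h | (c * π h) • x = y} := by ext; simp
  rw [this, measure_biUnion_null_iff hF.countable]
  exact fun y _ => hone y

end Stabilizers

/-- Every ball is infinite, because otherwise `G` would be a countable union of null sets. -/
theorem IsStronglyTopological.exists_mem_ball_notMem {X G : Type*} [MetricSpace X]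
    [SecondCountableTopology X]
    [Group G] [TopologicalSpace G] [IsTopologicalGroup G] [LocallyCompactSpace G]
    [SecondCountableTopology G] [MeasurableSpace G] [BorelSpace G]
    [MulAction G X] [IsIsometricSMul G X] (hstrong : IsStronglyTopological G X)
    (s : X) {q : ℝ} (hq : 0 < q) {F : Set X} (hF : F.Finite) :
    ∃ x ∈ Metric.ball s q, x ∉ F := by
  by_contra! hball
  have hnear : (Measure.haar : Measure G) {g | g • s ∈ F} = 0 := by
    have := hstrong.measure_hom_smul_mem (Y := ∅) (x := s) (by simp) (Measure.haar : Measure G)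
      (Subgroup.subtype _) continuous_subtype_val (MonoidHom.id G) continuous_id (by simp) 1 hF
    simpa using this
  obtain ⟨D, hDc, hD⟩ := TopologicalSpace.exists_countable_dense X
  have hcover : (Set.univ : Set G) ⊆ ⋃ d ∈ D, {g | g • s ∈ Metric.ball d (q / 2)} := by
    intro g _
    obtain ⟨d, hd, hdist⟩ := Metric.dense_iff.1 hD (g • s) (q / 2) (by positivity)
    simp only [Set.mem_iUnion]
    exact ⟨d, hdist, by simpa [dist_comm] using hd⟩
  have hnull : (Measure.haar : Measure G) Set.univ = 0 := by
    refine measure_mono_null hcover ((measure_biUnion_null_iff hDc).2 fun d _ => ?_)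
    -- Translated by `g₀⁻¹`, the elements of a nonempty piece send `s` into `ball s q`.
    by_cases hne : ∃ g₀ : G, g₀ • s ∈ Metric.ball d (q / 2)
    · obtain ⟨g₀, hg₀⟩ := hne
      rw [← measure_preimage_mul _ g₀]
      refine measure_mono_null (fun g hg => hball _ ?_) hnear
      simp only [Set.mem_preimage, Set.mem_ofPred_eq, Metric.mem_ball] at hg hg₀ ⊢
      rw [← dist_smul g₀, ← mul_smul]
      linarith [dist_triangle_right ((g₀ * g) • s) (g₀ • s) d]
    · convert measure_empty (μ := (Measure.haar : Measure G))
      refine Set.eq_empty_of_forall_notMem fun g hg => hne ⟨g, hg⟩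
  exact NeZero.ne _ (Measure.measure_univ_eq_zero.1 hnull)

/-! ### Conditioning on finitely many values. -/

namespace PartialAssignment

variable {t : ℕ} {G X : Type*} [Group G] [MulAction G X]

/-- The tuples `γ` such that `γᵢ` fixes `x` for all `(i, x) ∈ Y`. -/
def stab (G : Type*) [Group G] [MulAction G X] (Y : Set (Fin t × X)) : Subgroup (Fin t → G) where
  carrier := {γ | ∀ z ∈ Y, γ z.1 • z.2 = z.2}
  mul_mem' {a b} ha hb z hz := by
    rw [Pi.mul_apply, mul_smul, hb z hz, ha z hz]
  one_mem' z _ := by simp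
  inv_mem' {a} ha z hz := by
    rw [Pi.inv_apply, inv_smul_eq_iff, ha z hz]

theorem mem_stab {Y : Set (Fin t × X)} {γ : Fin t → G} :
    γ ∈ stab G Y ↔ ∀ z ∈ Y, γ z.1 • z.2 = z.2 := Iff.rfl

/-- The tuples `γ` and `g` take the same values at the points prescribed by `Y`. -/
def AgreeOn (g γ : Fin t → G) (Y : Set (Fin t × X)) : Prop :=
  ∀ z ∈ Y, γ z.1 • z.2 = g z.1 • z.2

theorem agreeOn_mul {Y : Set (Fin t × X)} (g : Fin t → G) {h : Fin t → G} (hh : h ∈ stab G Y) :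
    AgreeOn g (g * h) Y := fun z hz => by
  rw [Pi.mul_apply, mul_smul, hh z hz]

/-- The set of values at the points prescribed by `Y`. -/
def image (g : Fin t → G) (Y : Set (Fin t × X)) : Set (Fin t × X) :=
  (fun z => (z.1, g z.1 • z.2)) '' Y

theorem mem_image {g : Fin t → G} {Y : Set (Fin t × X)} {i : Fin t} {x : X} :
    (i, x) ∈ image g Y ↔ (i, (g i)⁻¹ • x) ∈ Y := by
  constructor
  · rintro ⟨⟨j, y⟩, hz, h⟩
    obtain ⟨rfl, rfl⟩ := Prod.mk.inj h
    simpa using hz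
  · exact fun h => ⟨_, h, by simp⟩

theorem image_congr {g γ : Fin t → G} {Y : Set (Fin t × X)} (h : AgreeOn g γ Y) :
    image γ Y = image g Y :=
  Set.image_congr fun z hz => by rw [h z hz]

theorem image_inv_image (g : Fin t → G) (Y : Set (Fin t × X)) : image g⁻¹ (image g Y) = Y := by
  ext ⟨i, x⟩
  simp [mem_image]

section Null

variable [TopologicalSpace G] [MeasurableSpace G]

/-- The set `A` is null in the coset of those tuples that agree with `g` on `Y`. -/
def NullAt (g : Fin t → G) (Y : Set (Fin t × X)) (A : Set (Fin t → G)) : Prop :=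
  ∀ ν : Measure (stab G Y), ν.IsHaarMeasure → ν {h | g * h ∈ A} = 0

theorem nullAt_of_forall_notMem {g : Fin t → G} {Y : Set (Fin t × X)} {A : Set (Fin t → G)}
    (h : ∀ γ, AgreeOn g γ Y → γ ∉ A) : NullAt g Y A := fun ν _ => by
  convert measure_empty (μ := ν)
  exact Set.eq_empty_of_forall_notMem fun k hk => h _ (agreeOn_mul g k.2) hk

variable [IsTopologicalGroup G]

theorem isClosed_stab (hstrong : IsStronglyTopological G X) (Y : Set (Fin t × X)) :
    IsClosed (stab G Y : Set (Fin t → G)) := by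
  have : (stab G Y : Set (Fin t → G)) = ⋂ z ∈ Y, {γ | γ z.1 • z.2 = z.2} := by
    ext γ; simp [mem_stab]
  rw [this]
  refine isClosed_biInter fun z _ => ?_
  have hz : Continuous fun γ : Fin t → G => γ z.1 := continuous_apply z.1
  exact (hstrong.isClosed_smul_eq z.2 z.2).preimage hz

instance [SecondCountableTopology G] (Y : Set (Fin t × X)) : SecondCountableTopology (stab G Y) :=
  TopologicalSpace.Subtype.secondCountableTopology _

theorem locallyCompactSpace_stab [LocallyCompactSpace G] (hstrong : IsStronglyTopological G X)
    (Y : Set (Fin t × X)) : LocallyCompactSpace (stab G Y) :=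
  (isClosed_stab hstrong Y).isClosedEmbedding_subtypeVal.locallyCompactSpace

/-- Conjugation by `g` as an isomorphism of stabilizers. -/
def conjStab (g : Fin t → G) (Y : Set (Fin t × X)) : stab G (image g Y) ≃ₜ* stab G Y where
  toFun k := ⟨g⁻¹ * k * g, fun z hz => by
    have := k.2 (z.1, g z.1 • z.2) (mem_image.2 (by simpa using hz))
    simp only [Pi.mul_apply, Pi.inv_apply, mul_smul]
    rw [this, inv_smul_smul]⟩
  invFun k := ⟨g * k * g⁻¹, fun z hz => by
    have := k.2 (z.1, (g z.1)⁻¹ • z.2) (mem_image.1 hz)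
    simp only [Pi.mul_apply, Pi.inv_apply, mul_smul]
    rw [this, smul_inv_smul]⟩
  left_inv k := by ext; simp [mul_assoc]
  right_inv k := by ext; simp [mul_assoc]
  map_mul' k l := by ext; simp [mul_assoc]
  continuous_toFun := by fun_prop
  continuous_invFun := by fun_prop

variable [LocallyCompactSpace G] [SecondCountableTopology G] [BorelSpace G]

/-- Since $(gh)^{-1}=g^{-1}(gh^{-1}g^{-1})$, inversion matches the two cosets; conjugation carries
Haar measures to Haar measures and inversion preserves null sets. -/
theorem NullAt.inv (hstrong : IsStronglyTopological G X) {g : Fin t → G} {Y : Set (Fin t × X)}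
    {A : Set (Fin t → G)} (h : NullAt g Y A) : NullAt g⁻¹ (image g Y) A⁻¹ := by
  intro ν hν
  have := locallyCompactSpace_stab hstrong (image g Y)
  have hmap : (ν.map (conjStab g Y)).IsHaarMeasure :=
    (conjStab g Y).isHaarMeasure_map ν
  have h0 := h _ hmap
  have h1 : ν ((conjStab g Y) ⁻¹' {h | g * h ∈ A}) = 0 :=
    le_antisymm (h0 ▸ Measure.le_map_apply (conjStab g Y).continuous.measurable.aemeasurable _)
      zero_le
  rw [← measure_inv_null, ← h1]
  congr 1
  ext k
  simp [conjStab, ← mul_assoc]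

/-- Conditioning in two stages: Fubini over the cosets of the smaller group `stab G Y'`, with `B`
the null set of discarded values. -/
theorem nullAt_of_subset (hstrong : IsStronglyTopological G X) {g : Fin t → G}
    {Y Y' : Set (Fin t × X)} (hY : Y ⊆ Y') {A B : Set (Fin t → G)} (hA : MeasurableSet A)
    (hB : NullAt g Y B) (h : ∀ γ, AgreeOn g γ Y → γ ∉ B → NullAt γ Y' A) : NullAt g Y A := by
  intro ν hν
  have := locallyCompactSpace_stab hstrong Y
  have := locallyCompactSpace_stab hstrong Y'
  have hle : stab G Y' ≤ stab G Y := fun γ hγ z hz => hγ z (hY hz)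
  have hm : Measurable fun k : stab G Y => g * (k : Fin t → G) :=
    (continuous_const.mul continuous_subtype_val).measurable
  have key := measure_mem_and_slice_null ν (Measure.haar : Measure (stab G Y'))
    (Subgroup.inclusion hle) (continuous_inclusion hle) (hm hA)
  refine measure_mono_null (fun k hk => ?_) (measure_union_null (hB ν hν) key)
  by_cases hkB : g * (k : Fin t → G) ∈ B
  · exact Or.inl hkB
  · refine Or.inr ⟨hk, ?_⟩
    have := h _ (agreeOn_mul g k.2) hkB Measure.haar inferInstance
    simpa [mul_assoc] using this

/-- Fubini along coordinate `j` alone, varied by the elements fixing all points prescribed for `j`.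
-/
theorem nullAt_smul_mem (hstrong : IsStronglyTopological G X) (g : Fin t → G)
    {Y : Set (Fin t × X)} (hY : Y.Finite) {j : Fin t} {p : X} (hp : (j, p) ∉ Y) {F : Set X}
    (hF : F.Finite) : NullAt g Y {γ | γ j • p ∈ F} := by
  classical
  intro ν hν
  have := locallyCompactSpace_stab hstrong Y
  have hfin : {x | (j, x) ∈ Y}.Finite := hY.preimage (Prod.mk_right_injective j).injOn
  let ι : fixingSubgroup G (hfin.toFinset : Set X) →* stab G Y :=
    ((MonoidHom.mulSingle (fun _ : Fin t => G) j).comp (Subgroup.subtype _)).codRestrict _ (by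
      rintro ⟨k, hk⟩ ⟨i, x⟩ hz
      by_cases hij : i = j
      · subst hij
        simpa using (mem_fixingSubgroup_iff G).1 hk x (by simpa using hz)
      · simp [hij])
  have := hstrong.measure_hom_smul_mem (Y := hfin.toFinset) (x := p) (by simpa using hp) ν ι
    (by
      refine Continuous.subtype_mk ?_ _
      exact (continuous_mulSingle j).comp continuous_subtype_val)
    ((Pi.evalMonoidHom (fun _ : Fin t => G) j).comp (Subgroup.subtype _))
    ((continuous_apply j).comp continuous_subtype_val)
    (by intro k; simp [ι]) (g j) hF
  simpa using this

/-- The value of the letter `yⱼ` (for `(j, true)`) or `yⱼ⁻¹` (for `(j, false)`). -/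
def letter (γ : Fin t → G) (a : Fin t × Bool) : G := cond a.2 (γ a.1) (γ a.1)⁻¹

/-- The point at which `γⱼ` has to be prescribed in order to determine the image of `p` under the
letter `a = yⱼ^{±1}`. -/
def source (γ : Fin t → G) (a : Fin t × Bool) (p : X) : Fin t × X :=
  (a.1, cond a.2 p ((γ a.1)⁻¹ • p))

theorem nullAt_step (hstrong : IsStronglyTopological G X) {g : Fin t → G} {Y : Set (Fin t × X)}
    (hY : Y.Finite) {a : Fin t × Bool} {p : X} (hp : source g a p ∉ Y) {F : Set X} (hF : F.Finite)
    {A : Set (Fin t → G)} (hA : MeasurableSet A)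
    (h : ∀ γ, AgreeOn g γ Y → letter γ a • p ∉ F → NullAt γ (insert (source γ a p) Y) A) :
    NullAt g Y A := by
  obtain ⟨j, b⟩ := a
  cases b with
  | true =>
    exact nullAt_of_subset hstrong (Set.subset_insert (j, p) _) hA
      (nullAt_smul_mem hstrong g hY (j := j) (p := p) hp hF) h
  | false =>
    -- An inverse letter becomes a positive one after inverting all tuples, which exchanges
    -- prescribed points and their images.
    suffices H : NullAt g⁻¹ (image g Y) A⁻¹ by
      simpa [image_inv_image] using H.inv hstrong
    refine nullAt_of_subset hstrong (Set.subset_insert (j, p) _) hA.inv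
      (nullAt_smul_mem hstrong g⁻¹ (hY.image _) (fun hj => hp (mem_image.1 hj)) hF)
      fun γ hγ hγF => ?_
    have hagree : AgreeOn g γ⁻¹ Y := fun z hz => by
      have := hγ (z.1, g z.1 • z.2) ⟨z, hz, rfl⟩
      rw [Pi.inv_apply, inv_smul_eq_iff, this]
      simp
    have := (h γ⁻¹ hagree (by simpa [letter] using hγF)).inv hstrong
    have himage : image γ⁻¹ (insert (source γ⁻¹ (j, false) p) Y) = insert (j, p) (image g Y) := by
      rw [← image_congr hagree]
      simp [image, Set.image_insert_eq, source]
    rwa [himage, inv_inv] at this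

end Null

end PartialAssignment

/-! ### Words as sequences of steps, and their inverses. -/

namespace PartialAssignment

variable {t : ℕ} {G X : Type*} [Group G] [MulAction G X]

/-- The inverse of a letter. -/
def flipLetter (a : Fin t × Bool) : Fin t × Bool := (a.1, !a.2)

@[simp] theorem flipLetter_flipLetter (a : Fin t × Bool) : flipLetter (flipLetter a) = a := by
  simp [flipLetter]

theorem letter_flipLetter (γ : Fin t → G) (a : Fin t × Bool) :
    letter γ (flipLetter a) = (letter γ a)⁻¹ := by
  obtain ⟨i, b⟩ := a
  cases b <;> simp [letter, flipLetter]

/-- For an inverse letter `source` depends on the tuple, but membership only asks whether `y` is a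
prescribed value. -/
theorem source_mem_congr {g γ : Fin t → G} {Y : Set (Fin t × X)} (h : AgreeOn g γ Y)
    {b : Fin t × Bool} {y : X} : source γ b y ∈ Y ↔ source g b y ∈ Y := by
  obtain ⟨i, b⟩ := b
  cases b with
  | true => rfl
  | false =>
    change (i, (γ i)⁻¹ • y) ∈ Y ↔ (i, (g i)⁻¹ • y) ∈ Y
    rw [← mem_image, ← mem_image, image_congr h]

/-- One prescribed value determines a letter at its source and the inverse letter at its target,
nothing else. -/
theorem source_mem_insert {γ : Fin t → G} {Y : Set (Fin t × X)} {a b : Fin t × Bool} {p y : X}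
    (h : source γ b y ∈ insert (source γ a p) Y) :
    source γ b y ∈ Y ∨ (b = a ∧ y = p) ∨ (b = flipLetter a ∧ y = letter γ a • p) := by
  rcases h with h | h
  · right
    obtain ⟨i, a⟩ := a
    obtain ⟨j, b⟩ := b
    obtain ⟨rfl, h⟩ := Prod.mk.inj h
    dsimp only at h
    cases a <;> cases b <;>
      simp_all [letter, flipLetter, inv_smul_eq_iff]
  · exact Or.inl h

theorem finite_setOf_source_mem (g : Fin t → G) {Y : Set (Fin t × X)} (hY : Y.Finite) :
    {y | ∃ b, source g b y ∈ Y}.Finite := by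
  refine ((hY.image Prod.snd).union ((hY.image _ : (image g Y).Finite).image Prod.snd)).subset ?_
  rintro y ⟨⟨i, b⟩, hb⟩
  cases b with
  | true => exact Or.inl ⟨_, hb, rfl⟩
  | false => exact Or.inr ⟨(i, y), mem_image.2 hb, rfl⟩

theorem letter_smul_eq {γ γ' : Fin t → G} {Y : Set (Fin t × X)} {a : Fin t × Bool} {p : X}
    (h : AgreeOn γ γ' Y) (hp : source γ a p ∈ Y) : letter γ' a • p = letter γ a • p := by
  obtain ⟨i, a⟩ := a
  have := h _ hp
  cases a with
  | true => exact this
  | false =>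
    have h' : γ' i • (γ i)⁻¹ • p = p := by simpa [source] using this
    change (γ' i)⁻¹ • p = (γ i)⁻¹ • p
    rw [inv_smul_eq_iff, h']

/-- The value of `aₙ eₙ ⋯ a₁ e₁` for a list of constants `eᵢ` and letters `aᵢ`. -/
def evalSteps (γ : Fin t → G) : List (G × (Fin t × Bool)) → G
  | [] => 1
  | z :: l => evalSteps γ l * (letter γ z.2 * z.1)

theorem evalSteps_append (γ : Fin t → G) (l l' : List (G × (Fin t × Bool))) :
    evalSteps γ (l ++ l') = evalSteps γ l' * evalSteps γ l := by
  induction l with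
  | nil => simp [evalSteps]
  | cons z l ih => simp [evalSteps, ih, mul_assoc]

/-- In `a' e' a e` there is no cancellation between `a` and `a'`. -/
def NoCancel (z z' : G × (Fin t × Bool)) : Prop := z'.1 = 1 → z'.2 ≠ flipLetter z.2

/-- The letters and constants of the inverse of a product of steps, given in reverse order and with
an additional constant `c` at its right. -/
def reverseSteps (c : G) : List (G × (Fin t × Bool)) → List (G × (Fin t × Bool))
  | [] => []
  | z :: l => (c, flipLetter z.2) :: reverseSteps z.1⁻¹ l

/-- The leftmost constant of the inverse word. -/
def reverseEnd (c : G) : List (G × (Fin t × Bool)) → G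
  | [] => c
  | z :: l => reverseEnd z.1⁻¹ l

/-- Inversion moves each constant to the other side of its letter, so constants shift by one place
and one is left over. -/
theorem reverseEnd_mul_evalSteps (γ : Fin t → G) (c : G) (l : List (G × (Fin t × Bool))) :
    reverseEnd c l * evalSteps γ (reverseSteps c l) = (evalSteps γ l.reverse)⁻¹ * c := by
  induction l generalizing c with
  | nil => simp [reverseEnd, reverseSteps, evalSteps]
  | cons z l ih =>
    simp only [reverseEnd, reverseSteps, evalSteps, List.reverse_cons, evalSteps_append,
      letter_flipLetter, ← mul_assoc, ih]
    simp [mul_assoc]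

theorem length_reverseSteps (c : G) (l : List (G × (Fin t × Bool))) :
    (reverseSteps c l).length = l.length := by
  induction l generalizing c with
  | nil => rfl
  | cons z l ih => simp [reverseSteps, ih]

theorem forall_mem_reverseSteps {P : G → Prop} {c : G} {l : List (G × (Fin t × Bool))} (hc : P c)
    (hl : ∀ z ∈ l, P z.1⁻¹) : ∀ z ∈ reverseSteps c l, P z.1 := by
  induction l generalizing c with
  | nil => simp [reverseSteps]
  | cons z l ih =>
    simp only [reverseSteps, List.forall_mem_cons] at hl ⊢
    exact ⟨hc, ih hl.1 hl.2⟩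

theorem isChain_reverseSteps {c : G} {l : List (G × (Fin t × Bool))}
    (hl : l.IsChain fun z z' => NoCancel z' z) : (reverseSteps c l).IsChain NoCancel := by
  induction l generalizing c with
  | nil => simp [reverseSteps]
  | cons z l ih =>
    cases l with
    | nil => simp [reverseSteps]
    | cons z' l =>
      rw [List.isChain_cons_cons] at hl
      have := ih (c := z.1⁻¹) hl.2
      simp only [reverseSteps, List.isChain_cons_cons] at this ⊢
      refine ⟨fun h h' => hl.1 (by simpa using h) ?_, this⟩
      simpa using h'.symm

section Measurability

variable [TopologicalSpace G] [IsTopologicalGroup G]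

theorem continuous_evalSteps (l : List (G × (Fin t × Bool))) :
    Continuous fun γ : Fin t → G => evalSteps γ l := by
  induction l with
  | nil => exact continuous_const
  | cons z l ih =>
    refine ih.mul (Continuous.mul ?_ continuous_const)
    obtain ⟨e, i, b⟩ := z
    cases b with
    | true => exact continuous_apply i
    | false => exact (continuous_apply i).inv

variable [SecondCountableTopology G] [MeasurableSpace G] [BorelSpace G]

/-- The intersection over `X` may be uncountable, so closedness of each condition is what matters.
-/
theorem measurableSet_forall_smul_eq (hstrong : IsStronglyTopological G X) (f : G)
    (l : List (G × (Fin t × Bool))) :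
    MeasurableSet {γ : Fin t → G | ∀ x : X, (f * evalSteps γ l) • x = x} := by
  have : {γ : Fin t → G | ∀ x : X, (f * evalSteps γ l) • x = x} =
      ⋂ x : X, (fun γ => f * evalSteps γ l) ⁻¹' {g : G | g • x = x} := by
    ext; simp
  rw [this]
  exact (isClosed_iInter fun x => (hstrong.isClosed_smul_eq x x).preimage
    (continuous_const.mul (continuous_evalSteps l))).measurableSet

end Measurability

/-! ### Trajectories through fresh points. -/

section Walk

variable {X : Type*} [MetricSpace X] [MulAction G X]

theorem AgreeOn.mem_moveLT {g γ : Fin t → G} {Y : Set (Fin t × X)} {s : X} {q : ℝ}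
    (h : AgreeOn g γ Y) (hs : ∀ i, (i, s) ∈ Y) (hg : ∀ i, g i ∈ moveLT G q s) (i : Fin t) :
    γ i ∈ moveLT G q s := by
  change dist (γ i • s) s < q
  rw [h (i, s) (hs i)]
  exact hg i

variable [IsIsometricSMul G X]

theorem dist_smul_lt {v : G} {s p : X} {q r : ℝ} (hv : dist (v • s) s < q) (hp : dist p s < r) :
    dist (v • p) s < r + q := by
  have := dist_triangle (v • p) (v • s) s
  rw [dist_smul] at this
  linarith

theorem dist_inv_smul_self (v : G) (s : X) : dist (v⁻¹ • s) s = dist (v • s) s := by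
  rw [← dist_smul v, smul_inv_smul, dist_comm]

theorem dist_letter_smul_lt {γ : Fin t → G} {s : X} {q : ℝ} (hγ : ∀ i, γ i ∈ moveLT G q s)
    (a : Fin t × Bool) : dist (letter γ a • s) s < q := by
  obtain ⟨i, a⟩ := a
  cases a with
  | true => exact hγ i
  | false => exact (dist_inv_smul_self (γ i) s).trans_lt (hγ i)

/-- The constant moves `s` by less than `q`, and it is trivial or has no fixed point in the ball of
radius `R` about `s`. -/
def IsAdmissible (s : X) (q R : ℝ) (v : G) : Prop :=
  dist (v • s) s < q ∧ (v = 1 ∨ ∀ y ∈ Metric.ball s R, v • y ≠ y)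

theorem IsAdmissible.inv {s : X} {q R : ℝ} {v : G} (hv : IsAdmissible s q R v) :
    IsAdmissible s q R v⁻¹ := by
  refine ⟨(dist_inv_smul_self v s).trans_lt hv.1, hv.2.imp (by simp) fun h y hy h' => h y hy ?_⟩
  rw [inv_smul_eq_iff] at h'
  exact h'.symm

variable [TopologicalSpace G] [IsTopologicalGroup G] [LocallyCompactSpace G]
  [SecondCountableTopology G] [MeasurableSpace G] [BorelSpace G]

/-- To prove that `A` is null in the coset given by `(g, Y)` one may follow the trajectory of `p` under
the steps `l` and assume that all points met after the first letter are new. -/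
theorem nullAt_of_walk (hstrong : IsStronglyTopological G X) {A : Set (Fin t → G)}
    (hA : MeasurableSet A) {s : X} {q R : ℝ} (hq : 0 < q) {F₀ : Set X} (hF₀ : F₀.Finite)
    (l : List (G × (Fin t × Bool))) (g : Fin t → G) (Y : Set (Fin t × X)) (p : X) (ρ : ℝ)
    (hY : Y.Finite) (hs : ∀ i, (i, s) ∈ Y) (hg : ∀ i, g i ∈ moveLT G q s)
    (hhead : ∀ z ∈ l.head?, source g z.2 (z.1 • p) ∉ Y)
    (hadm : ∀ z ∈ l, IsAdmissible s q R z.1) (hchain : l.IsChain NoCancel)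
    (hp : dist p s < ρ) (hρ : ρ + 2 * q * (l.length - 1) ≤ R)
    (H : ∀ γ Y', AgreeOn g γ Y → Y ⊆ Y' → Y'.Finite →
      (∀ y ∈ F₀, ∀ b, source γ b y ∈ Y' →
        source g b y ∈ Y ∨ ∃ z ∈ l.head?, b = z.2 ∧ y = z.1 • p) →
      (l ≠ [] → evalSteps γ l • p ∉ F₀) →
      (∀ γ', AgreeOn γ γ' Y' → evalSteps γ' l • p = evalSteps γ l • p) → NullAt γ Y' A) :
    NullAt g Y A := by
  induction l generalizing g Y p ρ with
  | nil =>
    exact H g Y (fun _ _ => rfl) subset_rfl hY (fun y _ b h => Or.inl h) (by simp)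
      (by simp [evalSteps])
  | cons z l ih =>
    obtain ⟨e, a⟩ := z
    set U : Set X := insert (e • p) (F₀ ∪ {y | ∃ b, source g b y ∈ Y}) with hU
    have hUfin : U.Finite := (hF₀.union (finite_setOf_source_mem g hY)).insert _
    -- The next constant: both `r` and `e' • r` must avoid `U`. The default `1` after the last step
    -- adds no condition.
    set e' : G := (l.head?.map Prod.fst).getD 1 with he'
    have hFfin : (U ∪ {y | e' • y ∈ U}).Finite :=
      hUfin.union (hUfin.preimage (MulAction.injective e').injOn)
    refine nullAt_step hstrong hY (hhead _ rfl) hFfin hA fun γ hγ hr => ?_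
    simp only [Set.mem_union, not_or] at hr
    obtain ⟨hrU, hrU'⟩ := hr
    set r := letter γ a • e • p with hr_def
    have hdist : dist r s < ρ + 2 * q := by
      have := dist_smul_lt (dist_letter_smul_lt (hγ.mem_moveLT hs hg) a)
        (dist_smul_lt (hadm (e, a) (by simp)).1 hp)
      rw [hr_def]; linarith
    refine ih γ (insert (source γ a (e • p)) Y) r (ρ + 2 * q) (hY.insert _)
      (fun i => Or.inr (hs i)) (hγ.mem_moveLT hs hg) ?_ (fun z hz => hadm z (by simp [hz]))
      hchain.tail hdist (by simp only [List.length_cons] at hρ; push_cast at hρ; linarith) ?_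
    · intro z hz hmem
      have hez : e' = z.1 := by simp [he', Option.mem_def.1 hz]
      rw [hez] at hrU'
      rcases source_mem_insert hmem with h | ⟨-, h⟩ | ⟨h, h'⟩
      · exact hrU' (Or.inr (Or.inr ⟨_, (source_mem_congr hγ).1 h⟩))
      · exact hrU' (Or.inl h)
      -- Backtracking: `e'` fixes `r`, and the next letter undoes the current one.
      · have hzl : z ∈ l := List.mem_of_mem_head? hz
        rcases (hadm z (by simp [hzl])).2 with h1 | h1
        · have := List.isChain_cons.1 hchain
          exact this.1 z hz h1 h
        · refine h1 r ?_ h'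
          have hlen : (1 : ℝ) ≤ l.length := by exact_mod_cast List.length_pos_of_mem hzl
          simp only [List.length_cons] at hρ
          push_cast at hρ
          rw [Metric.mem_ball]
          nlinarith
    · intro γ' Y' hγ' hYY' hY' hdet hend hconst
      have hsrc : source γ a (e • p) ∈ insert (source γ a (e • p)) Y := Or.inl rfl
      have heq : ∀ γ'', AgreeOn γ' γ'' Y' → letter γ'' a • e • p = r := fun γ'' h => by
        refine letter_smul_eq (Y := insert (source γ a (e • p)) Y) (fun z hz => ?_) hsrc
        rw [h z (hYY' hz), hγ' z hz]
      have heval : ∀ γ'', AgreeOn γ' γ'' Y' →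
          evalSteps γ'' ((e, a) :: l) • p = evalSteps γ'' l • r := fun γ'' h => by
        simp only [evalSteps, mul_smul, heq γ'' h]
      refine H γ' Y' (fun z hz => ?_) ((Set.subset_insert _ _).trans hYY') hY' ?_ ?_ ?_
      · rw [hγ' z (Or.inr hz), hγ z hz]
      · intro y hy b hb
        rcases hdet y hy b hb with h | ⟨z, hz, -, rfl⟩
        · rcases source_mem_insert h with h | ⟨rfl, rfl⟩ | ⟨-, rfl⟩
          · exact Or.inl ((source_mem_congr hγ).1 h)
          · exact Or.inr ⟨_, rfl, rfl, rfl⟩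
          · exact absurd (Or.inr (Or.inl hy)) hrU
        · have hez : e' = z.1 := by simp [he', Option.mem_def.1 hz]
          exact absurd (Or.inr (Or.inl (hez ▸ hy))) hrU'
      · intro _
        rw [heval γ' fun _ _ => rfl]
        by_cases hl : l = []
        · subst hl
          simpa [evalSteps] using fun h => hrU (Or.inr (Or.inl h))
        · exact hend hl
      · intro γ'' h
        rw [heval γ'' h, heval γ' fun _ _ => rfl, hconst γ'' h]

/-- Among the tuples that agree with `g` at `s`, almost none lies in the kernel of the word map. The
trajectory is started in the middle of the word and followed in both directions, so that it does not
leave the ball in which the constants have no fixed points. -/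
theorem nullAt_forall_smul_eq [SecondCountableTopology X] (hstrong : IsStronglyTopological G X)
    {s : X} {q : ℝ} {l : List (G × (Fin t × Bool))} (hl : l ≠ []) (f : G)
    (hadm : ∀ z ∈ l, IsAdmissible s q (l.length * q) z.1) (hchain : l.IsChain NoCancel)
    {g : Fin t → G} (hg : ∀ i, g i ∈ moveLT G q s) :
    NullAt g (Set.range fun i => (i, s)) {γ | ∀ x : X, (f * evalSteps γ l) • x = x} := by
  have hA := measurableSet_forall_smul_eq hstrong f l
  have hlen : 0 < l.length := List.length_pos_iff.2 hl
  have hq : 0 < q := dist_nonneg.trans_lt (hadm _ (List.head_mem hl)).1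
  have hs : dist s s < q := by simpa using hq
  -- The two bounds make `q + 2q(k - 1) ≤ Lq` for the number of steps `k` of either walk, that is
  -- `|l₁|` or `|l₂| + 1`.
  obtain ⟨l₁, e, a, l₂, rfl, hl₁, hl₂⟩ : ∃ l₁ e a l₂, l = l₁ ++ (e, a) :: l₂ ∧
      2 * l₁.length ≤ l.length ∧ 2 * l₂.length + 1 ≤ l.length := by
    have hm : l.length / 2 < l.length := Nat.div_lt_self hlen one_lt_two
    refine ⟨l.take (l.length / 2), (l[l.length / 2]).1, (l[l.length / 2]).2,
      l.drop (l.length / 2 + 1), by simp, ?_, ?_⟩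
    · simp only [List.length_take]; omega
    · simp only [List.length_drop]; omega
  set L : ℕ := (l₁ ++ (e, a) :: l₂).length with hL
  obtain ⟨hchain₁, hchain₂, hjoin⟩ := List.isChain_append.1 hchain
  set Y : Set (Fin t × X) := Set.range fun i => (i, s) with hYdef
  have hY : Y.Finite := Set.finite_range _
  have hsY : ∀ i, (i, s) ∈ Y := fun i => ⟨i, rfl⟩
  have hU := finite_setOf_source_mem g hY
  obtain ⟨x, hxs, hx⟩ := hstrong.exists_mem_ball_notMem s hq
    (hU.union (hU.preimage (MulAction.injective e).injOn))
  simp only [Set.mem_union, not_or] at hx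
  obtain ⟨hxU, hexU⟩ := hx
  have hL1 : (1 : ℝ) ≤ L := by exact_mod_cast hlen
  have hxball : x ∈ Metric.ball s (L * q) := Metric.ball_subset_ball (by nlinarith) hxs
  have hadm₁ : ∀ z ∈ reverseSteps 1 l₁.reverse, IsAdmissible s q (L * q) z.1 :=
    forall_mem_reverseSteps ⟨by simpa using hq, Or.inl rfl⟩ fun z hz =>
      (hadm z (by simp at hz; simp [hz])).inv
  -- The backward walk avoids `e • x`, where the forward walk will apply its first letter.
  refine nullAt_of_walk hstrong hA hq (Set.finite_singleton (e • x)) (reverseSteps 1 l₁.reverse)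
    g Y x q hY hsY hg ?_ hadm₁ (isChain_reverseSteps (List.isChain_reverse.2 hchain₁)) hxs ?_ ?_
  · intro z hz hmem
    cases hr : l₁.reverse with
    | nil => simp [hr, reverseSteps] at hz
    | cons z' r =>
      simp only [hr, reverseSteps, List.head?_cons, Option.mem_def, Option.some.injEq] at hz
      subst hz
      exact hxU ⟨_, by simpa using hmem⟩
  · rw [length_reverseSteps, List.length_reverse]
    have : (2 * l₁.length : ℝ) ≤ L := by exact_mod_cast hl₁
    nlinarith
  intro γ Y' hγ hYY' hY' hdet _ hconst
  -- The forward walk avoids the point that `f` would send to the end of the backward trajectory.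
  refine nullAt_of_walk hstrong hA hq
    (Set.finite_singleton (f⁻¹ • (reverseEnd 1 l₁.reverse *
      evalSteps γ (reverseSteps 1 l₁.reverse)) • x)) ((e, a) :: l₂)
    γ Y' x q hY' (fun i => hYY' (hsY i)) (hγ.mem_moveLT hsY hg) ?_
    (fun z hz => hadm z (List.mem_append_right _ hz)) hchain₂ hxs ?_ ?_
  · intro z hz hmem
    simp only [List.head?_cons, Option.mem_def, Option.some.injEq] at hz
    subst hz
    -- The remaining danger is the first backward step, taken at `x` itself; it matters only if `e •
    -- x = x` and the letters on both sides of `e` cancel.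
    rcases hdet _ rfl a hmem with h | ⟨z, hz, rfl, hz'⟩
    · exact hexU ⟨_, h⟩
    · cases hr : l₁.reverse with
      | nil => simp [hr, reverseSteps] at hz
      | cons z' r =>
        simp only [hr, reverseSteps, List.head?_cons, Option.mem_def, Option.some.injEq] at hz
        subst hz
        have hlast : z' ∈ l₁.getLast? := by
          rw [← List.head?_reverse, hr]; rfl
        rcases (hadm (e, flipLetter z'.2) (by simp)).2 with h1 | h1
        · exact hjoin z' hlast _ rfl h1 rfl
        · exact h1 x hxball (by simpa using hz')
  · have : (2 * l₂.length + 1 : ℝ) ≤ L := by exact_mod_cast hl₂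
    simp only [List.length_cons]
    push_cast
    nlinarith
  intro γ' Y'' hγ' hY'Y'' hY'' _ hend hconst'
  refine nullAt_of_forall_notMem fun γ'' hγ'' hker => hend (by simp) ?_
  have hback : evalSteps γ'' (reverseSteps 1 l₁.reverse) • x =
      evalSteps γ (reverseSteps 1 l₁.reverse) • x :=
    hconst γ'' fun z hz => by rw [hγ'' z (hY'Y'' hz), hγ' z hz]
  have hinv := reverseEnd_mul_evalSteps γ'' 1 l₁.reverse
  rw [List.reverse_reverse, mul_one] at hinv
  have hfix := hker ((evalSteps γ'' l₁)⁻¹ • x)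
  rw [evalSteps_append] at hfix
  simp only [mul_smul, smul_inv_smul] at hfix
  rw [Set.mem_singleton_iff, ← hconst' γ'' hγ'', mul_smul, ← hback, ← mul_smul (reverseEnd _ _),
    hinv, ← hfix, inv_smul_smul]

end Walk

end PartialAssignment

/-! ### From reduced words to steps, and from $O_w$ to fixed-point-free constants. -/

namespace MixedForm

open PartialAssignment

variable {t : ℕ} {G : Type*} [Group G]

/-- The steps of the product `u v`. -/
def blockSteps (v : G) : List (Fin t × Bool) → List (G × (Fin t × Bool))
  | [] => []
  | a :: l => (v, a) :: l.map fun b => (1, b)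

theorem evalSteps_map_one (γ : Fin t → G) (L : List (Fin t × Bool)) :
    evalSteps γ (L.map fun b => (1, b)) = FreeGroup.lift γ (FreeGroup.mk L.reverse) := by
  induction L with
  | nil => simp [evalSteps]
  | cons a L ih =>
    rw [List.map_cons, evalSteps, ih, List.reverse_cons, ← FreeGroup.mul_mk, map_mul]
    simp [letter]

theorem evalSteps_blockSteps (γ : Fin t → G) (v : G) {u : FreeGroup (Fin t)} (hu : u ≠ 1) :
    evalSteps γ (blockSteps v u.toWord.reverse) = FreeGroup.lift γ u * v := by
  have h := evalSteps_map_one γ u.toWord.reverse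
  rw [List.reverse_reverse, FreeGroup.mk_toWord] at h
  cases hL : u.toWord.reverse with
  | nil => simp [FreeGroup.toWord_eq_nil_iff, hu] at hL
  | cons a L =>
    rw [← h, hL]
    simp [blockSteps, evalSteps, mul_assoc]

theorem length_blockSteps (v : G) (u : FreeGroup (Fin t)) :
    (blockSteps v u.toWord.reverse).length = u.norm := by
  rw [FreeGroup.norm, ← List.length_reverse (as := u.toWord)]
  cases u.toWord.reverse <;> simp [blockSteps]

theorem isChain_blockSteps (v : G) (u : FreeGroup (Fin t)) :
    (blockSteps v u.toWord.reverse).IsChain NoCancel := by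
  have h := FreeGroup.isReduced_toWord (x := u)
  rw [FreeGroup.IsReduced, ← List.isChain_reverse] at h
  have hflip : ∀ {a b : Fin t × Bool}, (b.1 = a.1 → b.2 = a.2) → b ≠ flipLetter a := by
    rintro ⟨i, a⟩ ⟨j, b⟩ h h'
    obtain ⟨rfl, rfl⟩ := Prod.mk.inj h'
    simpa using h rfl
  cases hL : u.toWord.reverse with
  | nil => simp [blockSteps]
  | cons a L =>
    rw [hL, List.isChain_cons] at h
    rw [blockSteps, List.isChain_cons, List.isChain_map]
    refine ⟨?_, h.2.imp fun a b hab _ => hflip hab⟩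
    intro z hz _
    simp only [List.head?_map, Option.mem_def, Option.map_eq_some_iff] at hz
    obtain ⟨b, hb, rfl⟩ := hz
    exact hflip (h.1 b hb)

theorem eq_one_or_of_mem_blockSteps {v : G} {L : List (Fin t × Bool)} {z : G × (Fin t × Bool)}
    (hz : z ∈ blockSteps v L) : z.1 = 1 ∨ z.1 = v := by
  cases L with
  | nil => simp [blockSteps] at hz
  | cons a L =>
    rcases List.mem_cons.1 hz with rfl | hz
    · exact Or.inr rfl
    · obtain ⟨b, -, rfl⟩ := List.mem_map.1 hz
      exact Or.inl rfl

theorem eq_of_mem_head?_blockSteps {v : G} {L : List (Fin t × Bool)} {z : G × (Fin t × Bool)}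
    (hz : z ∈ (blockSteps v L).head?) : z.1 = v := by
  cases L with
  | nil => simp [blockSteps] at hz
  | cons a L =>
    simp only [blockSteps, List.head?_cons, Option.mem_def, Option.some.injEq] at hz
    rw [← hz]

theorem eval_blocks_cons (γ : Fin t → G) (b : FreeGroup (Fin t) × G)
    (l : List (FreeGroup (Fin t) × G)) :
    (blocks (b :: l)).eval γ = (blocks l).eval γ * (FreeGroup.lift γ b.1 * b.2) := by
  simp [eval, toWord, blocksWord]

/-- The nontrivial first constant prevents cancellation where blocks meet. If the leftmost free
factor is trivial, its constant becomes `f`. -/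
theorem exists_steps_blocks (l : List (FreeGroup (Fin t) × G)) (hl : (blocks l).IsReduced) :
    ∃ (S : List (G × (Fin t × Bool))) (f : G),
      (∀ γ, (blocks l).eval γ = f * evalSteps γ S) ∧ S.length = (blocks l).length ∧
      S.IsChain NoCancel ∧ (∀ z ∈ S, z.1 = 1 ∨ z.1 ∈ (blocks l).constants) ∧
      (∀ z ∈ S.head?, z.1 ≠ 1) ∧ (S = [] → f ≠ 1) := by
  induction l with
  | nil => exact absurd rfl hl.1
  | cons b l ih =>
    obtain ⟨u, v⟩ := b
    obtain ⟨-, hconst, hfree⟩ := hl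
    have hv : v ≠ 1 := hconst (u, v) (by simp)
    by_cases hl0 : l = []
    · subst hl0
      by_cases hu : u = 1
      · subst hu
        exact ⟨[], v, by simp [eval, toWord, blocksWord, evalSteps], by simp [length], by simp,
          by simp, by simp, fun _ => hv⟩
      · refine ⟨blockSteps v u.toWord.reverse, 1, fun γ => ?_, ?_, isChain_blockSteps v u,
          fun z hz => ?_, fun z hz => ?_, fun h => ?_⟩
        · rw [evalSteps_blockSteps γ v hu]
          simp [eval, toWord, blocksWord]
        · simp [length_blockSteps, length]
        · simpa [constants] using eq_one_or_of_mem_blockSteps hz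
        · rwa [eq_of_mem_head?_blockSteps hz]
        · have := length_blockSteps v u
          rw [h] at this
          simp [eq_comm, hu] at this
    · rw [List.dropLast_cons_of_ne_nil hl0] at hfree
      have hu : u ≠ 1 := hfree (u, v) (by simp)
      obtain ⟨S, f, heval, hlen, hchain, hmem, hhead, -⟩ :=
        ih ⟨hl0, fun b hb => hconst b (by simp [hb]), fun b hb => hfree b (by simp [hb])⟩
      have hne : blockSteps v u.toWord.reverse ≠ [] := fun h => by
        have := length_blockSteps v u
        rw [h] at this
        simp [eq_comm, hu] at this
      refine ⟨blockSteps v u.toWord.reverse ++ S, f, fun γ => ?_, ?_, ?_, ?_, ?_, ?_⟩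
      · rw [eval_blocks_cons, heval, evalSteps_append, evalSteps_blockSteps γ v hu, mul_assoc]
      · simp [length_blockSteps, hlen, length]
      · exact List.isChain_append.2
          ⟨isChain_blockSteps v u, hchain, fun _ _ z hz h => absurd h (hhead z hz)⟩
      · intro z hz
        rcases List.mem_append.1 hz with hz | hz
        · exact (eq_one_or_of_mem_blockSteps hz).imp_right fun h => by simp [constants, h]
        · exact (hmem z hz).imp_right fun h => by
            simp only [constants, List.map_cons] at h ⊢
            exact List.mem_cons_of_mem _ h
      · intro z hz
        rw [List.head?_append_of_ne_nil _ hne] at hz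
        rwa [eq_of_mem_head?_blockSteps hz]
      · simp [hne]

/-- A reduced nontrivial word as a sequence of constants and letters without cancellation. -/
theorem exists_steps (w : MixedForm t G) (hred : w.IsReduced) (hw : w.toWord ≠ 1) :
    ∃ (S : List (G × (Fin t × Bool))) (f : G),
      (∀ γ, w.eval γ = f * evalSteps γ S) ∧ S.length = w.length ∧
      S.IsChain NoCancel ∧ (∀ z ∈ S, z.1 = 1 ∨ z.1 ∈ w.constants) ∧ (S = [] → f ≠ 1) := by
  cases w with
  | free u =>
    have hu : u ≠ 1 := by
      rintro rfl
      simp [toWord] at hw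
    refine ⟨blockSteps 1 u.toWord.reverse, 1, fun γ => ?_, length_blockSteps 1 u,
      isChain_blockSteps 1 u, fun z hz => ?_, fun h => ?_⟩
    · rw [evalSteps_blockSteps γ 1 hu]
      simp [eval, toWord]
    · exact Or.inl (by simpa using eq_one_or_of_mem_blockSteps hz)
    · have := length_blockSteps (1 : G) u
      rw [h] at this
      simp [eq_comm, hu] at this
  | blocks l =>
    obtain ⟨S, f, h₁, h₂, h₃, h₄, -, h₅⟩ := exists_steps_blocks l hred
    exact ⟨S, f, h₁, h₂, h₃, h₄, h₅⟩

variable {X : Type*} [MetricSpace X] [MulAction G X] [IsIsometricSMul G X]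

/-- In the induction `p` runs through the images of the starting point under successive constants.
It stays within `q` of `s`, so a ball of radius `R + q` about it contains `ball s R`. -/
theorem smul_ne_of_ball_subset_blocksOscSet {s : X} {q R : ℝ}
    (l : List (FreeGroup (Fin t) × G)) {p : X} (hp : p ∈ Metric.ball s q)
    (hinv : ∀ b ∈ l, ∀ x ∈ Metric.ball s q, b.2 • x ∈ Metric.ball s q)
    (hball : Metric.ball p (R + q) ⊆ blocksOscSet X l) :
    ∀ b ∈ l, ∀ y ∈ Metric.ball s R, b.2 • y ≠ y := by
  induction l generalizing p with
  | nil => simp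
  | cons b l ih =>
    rw [List.forall_mem_cons] at hinv ⊢
    refine ⟨fun y hy => (hball ?_).1, ih (hinv.1 p hp) hinv.2 fun y hy => ?_⟩
    · rw [Metric.mem_ball] at hy hp ⊢
      linarith [dist_triangle_right y p s]
    · have hy' : b.2⁻¹ • y ∈ Metric.ball p (R + q) := by
        rw [Metric.mem_ball, ← dist_smul b.2, smul_inv_smul]
        exact hy
      simpa using (hball hy').2

theorem smul_ne_of_ball_subset_oscSet {s : X} {q R : ℝ} (hq : 0 < q) (w : MixedForm t G)
    (hinv : ∀ v ∈ w.constants, ∀ x ∈ Metric.ball s q, v • x ∈ Metric.ball s q)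
    (hball : Metric.ball s (R + q) ⊆ w.oscSet X) :
    ∀ v ∈ w.constants, ∀ y ∈ Metric.ball s R, v • y ≠ y := by
  cases w with
  | free u => simp [constants]
  | blocks l =>
    simp only [constants, List.forall_mem_map] at hinv ⊢
    exact smul_ne_of_ball_subset_blocksOscSet l (Metric.mem_ball_self hq) hinv hball

end MixedForm

/-! ### Conclusion. -/

theorem theorem3p3 {X G : Type*} [MetricSpace X] [PolishSpace X]
    [Group G] [TopologicalSpace G] [IsTopologicalGroup G] [LocallyCompactSpace G]
    [SecondCountableTopology G] [MeasurableSpace G] [BorelSpace G]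
    [MulAction G X] [IsIsometricSMul G X]
    (hstrong : IsStronglyTopological G X)
    (hstab : ∀ Y : Finset X, fixingSubgroup G (Y : Set X) ≠ ⊥)
    (μ : Measure G) [μ.IsHaarMeasure]
    (s : X) (q : ℝ) (t : ℕ) (w : MixedForm t G)
    (hred : w.IsReduced) (hosc : w.ExplicitlyOscillating X)
    (hball : Metric.ball s ((w.length + 1) * q) ⊆ w.oscSet X)
    (hinv : ∀ v ∈ w.constants, ∀ x ∈ Metric.ball s q, v • x ∈ Metric.ball s q) :
    ∀ᵐ γ ∂(Measure.pi fun _ : Fin t => μ),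
      (∀ i, γ i ∈ moveLT G q s) → w.eval γ ≠ 1 := by
  obtain ⟨S, f, heval, hlen, hchain, hmem, hf⟩ := w.exists_steps hred hosc.1
  by_cases hS : S = []
  · refine Filter.Eventually.of_forall fun γ _ => ?_
    rw [heval, hS]
    simpa [PartialAssignment.evalSteps] using hf hS
  set Y : Set (Fin t × X) := Set.range fun i => (i, s)
  have := PartialAssignment.locallyCompactSpace_stab (G := G) hstrong Y
  -- Conditioning on the values at `s` fixes whether the tuple lies in $N^q(s,\mathrm{id})^t$.
  -- Elements acting trivially replace the identity, giving a measurable set that contains all bad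
  -- tuples.
  have key := measure_mem_and_slice_null (Measure.pi fun _ : Fin t => μ)
    (Measure.haar : Measure (PartialAssignment.stab G Y)) (Subgroup.subtype _) continuous_subtype_val
    (PartialAssignment.measurableSet_forall_smul_eq hstrong f S)
  rw [ae_iff]
  refine measure_mono_null (fun γ hγ => ?_) key
  obtain ⟨hγN, hγw⟩ : (∀ i, γ i ∈ moveLT G q s) ∧ w.eval γ = 1 := by simpa using hγ
  -- `S` has a letter, so `t` is positive and some coordinate moves `s` by less than `q`.
  have hq : 0 < q := dist_nonneg.trans_lt (hγN (S.head hS).2.1)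
  have hs : s ∈ Metric.ball s q := Metric.mem_ball_self hq
  refine ⟨fun x => by rw [← heval, hγw, one_smul],
    PartialAssignment.nullAt_forall_smul_eq hstrong hS f (fun z hz => ?_) hchain hγN _ inferInstance⟩
  rw [hlen]
  rcases hmem z hz with h | h
  · exact ⟨by simpa [h] using hq, Or.inl h⟩
  · exact ⟨hinv _ h s hs, Or.inr (MixedForm.smul_ne_of_ball_subset_oscSet hq w hinv
      (by rwa [add_mul, one_mul] at hball) _ h)⟩
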